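/- Let $A\ge 2$, $\alpha_1,\dots,\alpha_A>0$, $\beta\ge 1$, and let $F_i(k)=\alpha_i k^\beta$ for $i\in[A]=\{1,\dots,A\}$. Write $\Delta_{A-1}=\{x\in[0,1]^A:\sum_{i=1}^A x_i=1\}$. For a labor share $r\in[0,1]$, a wage vector $\gamma\in\Delta_{A-1}$ and initial wealths $X(0)\in[1,\infty)^A$ with total $N=\sum_{i=1}^A X_i(0)$, let $(X(n))_{n\ge 0}$ be the Markov chain started in $X(0)$ with transition law $$\sum_{i=1}^A p_i(x)\,\delta_{x+v^{(i)}}\ \text{ from } x,\qquad p_i(x)=\frac{F_i(x_i)}{F_1(x_1)+\dots+F_A(x_A)},\qquad v^{(i)}=(1-r)e^{(i)}+r\gamma,$$ where $e^{(i)}$ is the $i$-th unit vector. Let $\chi(n)=X(n)/(N+n)\in\Delta_{A-1}$ be the wealth shares, and let $G(x)=(1-r)p(x)+r\gamma-x$ for $x\in\Delta_{A-1}$. Then there is $r_c\in(0,1)$, depending only on $A$, $\alpha$ and $\beta$, such that for all $r\in[r_c,1]$ and all $\gamma\in\Delta_{A-1}$ the following holds. The field $G$ has exactly one zero $\chi(\infty)$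 in $\Delta_{A-1}$; for every $X(0)\in[1,\infty)^A$ the shares $\chi(n)$ converge almost surely, as $n\to\infty$, to the deterministic point $\chi(\infty)$; and $\chi_i(\infty)=0$ for every agent $i\in[A]$ with $\gamma_i=0$. -/

import Mathlib

open Filter Topology MeasureTheory

namespace WealthUrn

noncomputable section

/-- The homogeneous feedback functions `F_i(k) = α_i k ^ β`. -/
def powerFeedback {A : ℕ} (α : Fin A → ℝ) (β : ℝ) : Fin A → ℝ → ℝ :=
  fun i k => α i * k ^ β

/-- The probability that agent `i` wins the next unit of capital return when the vector of
wealths is `x`, namely `F_i(x_i) / (F_1(x_1) + ... + F_A(x_A))`. -/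
def winProb {A : ℕ} (F : Fin A → ℝ → ℝ) (x : Fin A → ℝ) : Fin A → ℝ :=
  fun i => F i (x i) / ∑ j, F j (x j)

/-- The increment `v^(i) = (1 - r) e^(i) + r γ` of the wealth vector when agent `i` wins. -/
def increment {A : ℕ} (r : ℝ) (γ : Fin A → ℝ) (i : Fin A) : Fin A → ℝ :=
  (1 - r) • Pi.single i (1 : ℝ) + r • γ

/-- `X` is the wealth process with labor share `r`, wages `γ`, feedback functions `F` and initial
wealths `x₀`: a Markov chain started in `x₀` which moves from `x` to `x + v^(i)` with
probability `winProb F x i`. The transition law `∑ i, winProb F x i • δ_(x + v^(i))` is expressed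
by its action on bounded measurable functions, so that coinciding increments (for `r = 1`) add
their probabilities. -/
structure IsWealthProcess {A : ℕ} (r : ℝ) (γ : Fin A → ℝ) (F : Fin A → ℝ → ℝ) (x₀ : Fin A → ℝ)
    {Ω : Type*} [MeasurableSpace Ω] (μ : Measure Ω) (X : ℕ → Ω → (Fin A → ℝ)) : Prop where
  stronglyMeasurable : ∀ n, StronglyMeasurable (X n)
  initial : ∀ᵐ ω ∂μ, X 0 ω = x₀
  markov : ∀ (n : ℕ) (f : (Fin A → ℝ) → ℝ), Measurable f → (∃ C, ∀ x, |f x| ≤ C) →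
    μ[fun ω => f (X (n + 1) ω) | Filtration.natural X stronglyMeasurable n] =ᵐ[μ]
      fun ω => ∑ i, winProb F (X n ω) i * f (X n ω + increment r γ i)

/-- The wealth shares `χ(n) = X(n) / (N + n)`, where `N` is the total initial wealth. -/
def shares {A : ℕ} (x₀ : Fin A → ℝ) {Ω : Type*} (X : ℕ → Ω → (Fin A → ℝ)) (n : ℕ) (ω : Ω) :
    Fin A → ℝ :=
  ((∑ i, x₀ i) + (n : ℝ))⁻¹ • X n ω

/-- The vector field `G(x) = (1 - r) p(x) + r γ - x` for the feedback `F_i(k) = α_i k ^ β`. -/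
def field {A : ℕ} (r : ℝ) (γ α : Fin A → ℝ) (β : ℝ) (x : Fin A → ℝ) : Fin A → ℝ :=
  (1 - r) • winProb (powerFeedback α β) x + r • γ - x

/-- For the feedback `F_i(k) = α_i k ^ β` the winning probabilities depend on the wealths only
through the shares, so that the field does not depend on the time. -/
theorem winProb_powerFeedback_smul {A : ℕ} (α : Fin A → ℝ) (β : ℝ) {c : ℝ} (hc : 0 < c)
    {x : Fin A → ℝ} (hx : ∀ i, 0 ≤ x i) :
    winProb (powerFeedback α β) (c • x) = winProb (powerFeedback α β) x := by
  have h : ∀ i, powerFeedback α β i ((c • x) i) = c ^ β * powerFeedback α β i (x i) := by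
    intro i
    simp only [powerFeedback, Pi.smul_apply, smul_eq_mul, Real.mul_rpow hc.le (hx i)]
    ring
  funext i
  simp only [winProb, h, ← Finset.mul_sum]
  exact mul_div_mul_left _ _ (Real.rpow_pos_of_pos hc β).ne'

end

end WealthUrn

namespace WealthUrn
noncomputable section

/-! Write T(x) = (1 - r) p(x) + r γ, so that G = T - id. Only the term (1 - r) p(x) depends on x,
and p is Lipschitz on the simplex: t ^ β is Lipschitz on [0, 1] because β ≥ 1, and the denominator
of p is bounded below by compactness. For r near 1, T is therefore a contraction, uniformly in γ,
and its fixed point z is the only zero of G. Faces belonging to wageless agents are invariant under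
T, so z lies in them (`exists_meanIncrement_fixedPoint`).

The shares form a stochastic approximation χ(n+1) = χ(n) + (v - χ(n)) / (N + n + 1), where v has
conditional mean T(χ(n)). The contraction makes |χ - z|² a Lyapunov function
(`sum_winProb_mul_sq_dist_le`). Its mean tends to 0, and a supermartingale argument gives an almost
sure limit, which must then be 0 (`ae_tendsto_zero_of_condExp_le`). -/

/-! ### Lipschitz continuity of the winning probabilities -/

theorem abs_rpow_sub_rpow_le {β : ℝ} (hβ : 1 ≤ β) {x y : ℝ} (hx : x ∈ Set.Icc (0 : ℝ) 1)
    (hy : y ∈ Set.Icc (0 : ℝ) 1) : |x ^ β - y ^ β| ≤ β * |x - y| := by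
  have h := Convex.norm_image_sub_le_of_norm_hasDerivWithin_le (𝕜 := ℝ)
    (f := fun t : ℝ => t ^ β) (f' := fun t => β * t ^ (β - 1)) (s := Set.Icc 0 1) (C := β)
    (fun t _ => (Real.hasDerivAt_rpow_const (Or.inr hβ)).hasDerivWithinAt)
    (fun t ht => by
      have h1 : t ^ (β - 1) ≤ 1 := Real.rpow_le_one ht.1 ht.2 (by linarith)
      have h0 : 0 ≤ t ^ (β - 1) := Real.rpow_nonneg ht.1 _
      rw [Real.norm_eq_abs, abs_of_nonneg (by positivity)]
      nlinarith) (convex_Icc 0 1) hy hx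
  simpa [Real.norm_eq_abs] using h

variable {A : ℕ} {α : Fin A → ℝ} {β : ℝ}

theorem powerFeedback_nonneg (hα : ∀ i, 0 < α i) {x : Fin A → ℝ} (hx : ∀ i, 0 ≤ x i) (i : Fin A) :
    0 ≤ powerFeedback α β i (x i) :=
  mul_nonneg (hα i).le (Real.rpow_nonneg (hx i) _)

theorem sum_powerFeedback_pos (hα : ∀ i, 0 < α i) {x : Fin A → ℝ} (hx : ∀ i, 0 ≤ x i)
    (hs : 0 < ∑ i, x i) : 0 < ∑ i, powerFeedback α β i (x i) := by
  obtain ⟨i, hi, hpos⟩ := Finset.exists_lt_of_sum_lt (s := Finset.univ) (f := fun _ : Fin A => (0 : ℝ))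
    (g := x) (by simpa using hs)
  exact Finset.sum_pos' (fun j _ => powerFeedback_nonneg hα hx j)
    ⟨i, hi, mul_pos (hα i) (Real.rpow_pos_of_pos hpos _)⟩

theorem winProb_nonneg (hα : ∀ i, 0 < α i) {x : Fin A → ℝ} (hx : ∀ i, 0 ≤ x i) (i : Fin A) :
    0 ≤ winProb (powerFeedback α β) x i :=
  div_nonneg (powerFeedback_nonneg hα hx i)
    (Finset.sum_nonneg fun j _ => powerFeedback_nonneg hα hx j)

theorem sum_winProb (hα : ∀ i, 0 < α i) {x : Fin A → ℝ} (hx : ∀ i, 0 ≤ x i)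
    (hs : 0 < ∑ i, x i) : ∑ i, winProb (powerFeedback α β) x i = 1 := by
  simp only [winProb, ← Finset.sum_div]
  exact div_self (sum_powerFeedback_pos hα hx hs).ne'

theorem winProb_mem_stdSimplex (hα : ∀ i, 0 < α i) {x : Fin A → ℝ} (hx : x ∈ stdSimplex ℝ (Fin A)) :
    winProb (powerFeedback α β) x ∈ stdSimplex ℝ (Fin A) :=
  ⟨winProb_nonneg hα hx.1, sum_winProb hα hx.1 (by simp [hx.2])⟩

theorem exists_sum_powerFeedback_lower_bound (hα : ∀ i, 0 < α i) (hβ : 1 ≤ β) :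
    ∃ d > 0, ∀ x ∈ stdSimplex ℝ (Fin A), d ≤ ∑ i, powerFeedback α β i (x i) := by
  rcases (stdSimplex ℝ (Fin A)).eq_empty_or_nonempty with h | h
  · exact ⟨1, one_pos, by simp [h]⟩
  have hc : Continuous fun x : Fin A → ℝ => ∑ i, powerFeedback α β i (x i) := by
    refine continuous_finsetSum _ fun i _ => continuous_const.mul ?_
    exact (continuous_apply i).rpow_const fun _ => Or.inr (by linarith)
  obtain ⟨x, hx, hmin⟩ := (isCompact_stdSimplex ℝ (Fin A)).exists_isMinOn h hc.continuousOn
  exact ⟨_, sum_powerFeedback_pos hα hx.1 (by simp [hx.2]), fun y hy => hmin hy⟩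

theorem exists_winProb_lipschitz (hα : ∀ i, 0 < α i) (hβ : 1 ≤ β) :
    ∃ L ≥ 0, ∀ x ∈ stdSimplex ℝ (Fin A), ∀ y ∈ stdSimplex ℝ (Fin A), ∀ i,
      |winProb (powerFeedback α β) x i - winProb (powerFeedback α β) y i|
        ≤ L * ∑ j, |x j - y j| := by
  obtain ⟨d, hd, hdle⟩ := exists_sum_powerFeedback_lower_bound (A := A) hα hβ
  have hβ0 : 0 ≤ β := by linarith
  set a := ∑ j, α j with ha
  have ha0 : 0 ≤ a := Finset.sum_nonneg fun j _ => (hα j).le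
  refine ⟨2 * (a * β) / d, by positivity, fun x hx y hy i => ?_⟩
  have hmem : ∀ z ∈ stdSimplex ℝ (Fin A), ∀ j, z j ∈ Set.Icc (0 : ℝ) 1 := fun z hz j =>
    ⟨hz.1 j, hz.2 ▸ Finset.single_le_sum (fun k _ => hz.1 k) (Finset.mem_univ j)⟩
  have hF : ∀ j, |powerFeedback α β j (x j) - powerFeedback α β j (y j)|
      ≤ a * β * |x j - y j| := by
    intro j
    rw [powerFeedback, powerFeedback, ← mul_sub, abs_mul, abs_of_pos (hα j), mul_assoc]
    exact mul_le_mul (Finset.single_le_sum (f := α) (fun k _ => (hα k).le) (Finset.mem_univ j))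
      (abs_rpow_sub_rpow_le hβ (hmem x hx j) (hmem y hy j)) (abs_nonneg _) ha0
  set S := ∑ j, |x j - y j| with hS
  have h1 : |powerFeedback α β i (x i) - powerFeedback α β i (y i)| ≤ a * β * S :=
    (hF i).trans (mul_le_mul_of_nonneg_left
      (Finset.single_le_sum (f := fun j => |x j - y j|) (fun k _ => abs_nonneg _)
        (Finset.mem_univ i)) (by positivity))
  have h2 : |∑ j, powerFeedback α β j (y j) - ∑ j, powerFeedback α β j (x j)| ≤ a * β * S := by
    rw [abs_sub_comm, ← Finset.sum_sub_distrib, hS, Finset.mul_sum]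
    exact (Finset.abs_sum_le_sum_abs _ _).trans (Finset.sum_le_sum fun j _ => hF j)
  have hp := winProb_mem_stdSimplex (β := β) hα hy
  have hp1 := hmem _ hp i
  have hDx := hdle x hx
  have hDy := hdle y hy
  -- Only one denominator remains: the factor 1 / D(y), with D the total feedback, is absorbed into
  -- p(y) ≤ 1.
  have key : winProb (powerFeedback α β) x i - winProb (powerFeedback α β) y i
      = ((powerFeedback α β i (x i) - powerFeedback α β i (y i))
        + winProb (powerFeedback α β) y i
          * (∑ j, powerFeedback α β j (y j) - ∑ j, powerFeedback α β j (x j)))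
        / ∑ j, powerFeedback α β j (x j) := by
    have hx0 : ∑ j, powerFeedback α β j (x j) ≠ 0 := by linarith
    have hy0 : ∑ j, powerFeedback α β j (y j) ≠ 0 := by linarith
    simp only [winProb]
    field_simp
    ring
  have hnum : |(powerFeedback α β i (x i) - powerFeedback α β i (y i))
        + winProb (powerFeedback α β) y i
          * (∑ j, powerFeedback α β j (y j) - ∑ j, powerFeedback α β j (x j))|
        ≤ 2 * (a * β) * S := by
    refine (abs_add_le _ _).trans ?_
    rw [abs_mul, abs_of_nonneg hp1.1]
    nlinarith [mul_le_mul hp1.2 h2 (abs_nonneg _) zero_le_one]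
  rw [key, abs_div, abs_of_pos (hd.trans_le hDx), div_mul_eq_mul_div]
  exact div_le_div₀ ((abs_nonneg _).trans hnum) hnum hd hDx

/-! ### Contraction and fixed point of the mean increment -/

/-- The expected increment `(1 - r) p(x) + r γ`, seen as a self-map of the simplex. -/
def meanIncrement (r : ℝ) (γ α : Fin A → ℝ) (β : ℝ) (x : Fin A → ℝ) : Fin A → ℝ :=
  (1 - r) • winProb (powerFeedback α β) x + r • γ

theorem meanIncrement_mem_stdSimplex (hα : ∀ i, 0 < α i) {r : ℝ} (hr0 : 0 ≤ r) (hr1 : r ≤ 1)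
    {γ : Fin A → ℝ} (hγ : γ ∈ stdSimplex ℝ (Fin A)) {x : Fin A → ℝ}
    (hx : x ∈ stdSimplex ℝ (Fin A)) : meanIncrement r γ α β x ∈ stdSimplex ℝ (Fin A) :=
  convex_stdSimplex ℝ (Fin A) (winProb_mem_stdSimplex hα hx) hγ (by linarith) hr0 (by ring)

/-- For labor shares close to one, `meanIncrement` is a contraction with constant `1 / 4`, both
for the supremum norm and, after pairing with `x - y`, for the Euclidean norm. -/
theorem exists_meanIncrement_contracting (hα : ∀ i, 0 < α i) (hβ : 1 ≤ β) :
    ∃ r_c : ℝ, 0 < r_c ∧ r_c < 1 ∧ ∀ r, r_c ≤ r → r ≤ 1 → ∀ γ : Fin A → ℝ,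
      ∀ x ∈ stdSimplex ℝ (Fin A), ∀ y ∈ stdSimplex ℝ (Fin A),
        dist (meanIncrement r γ α β x) (meanIncrement r γ α β y) ≤ 1 / 4 * dist x y ∧
        ∑ i, (meanIncrement r γ α β x i - meanIncrement r γ α β y i) * (x i - y i)
          ≤ 1 / 4 * ∑ i, (x i - y i) ^ 2 := by
  obtain ⟨L, hL, hLip⟩ := exists_winProb_lipschitz (A := A) hα hβ
  have hK : 0 ≤ L * A := by positivity
  -- Chosen so that (1 - r) L A ≤ 1/4; the added 1 keeps `r_c` positive and the denominator nonzero
  -- even if L A = 0.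
  refine ⟨1 - 1 / (4 * (L * A + 1)), ?_, ?_, fun r hr hr1 γ x hx y hy => ?_⟩
  · rw [sub_pos, div_lt_one (by positivity)]
    linarith
  · have : 0 < 1 / (4 * (L * A + 1)) := by positivity
    linarith
  have hs : (1 - r) * (L * A) ≤ 1 / 4 := by
    have h1 : 1 - r ≤ 1 / (4 * (L * A + 1)) := by linarith
    rw [le_div_iff₀ (by positivity)] at h1
    nlinarith
  have hs0 : 0 ≤ 1 - r := by linarith
  have hT : ∀ i, meanIncrement r γ α β x i - meanIncrement r γ α β y i
      = (1 - r) * (winProb (powerFeedback α β) x i - winProb (powerFeedback α β) y i) := by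
    intro i
    simp only [meanIncrement, Pi.add_apply, Pi.smul_apply, smul_eq_mul]
    ring
  constructor
  · rw [dist_pi_le_iff (by positivity)]
    intro i
    rw [Real.dist_eq, hT, abs_mul, abs_of_nonneg hs0]
    have h1 : ∑ j, |x j - y j| ≤ A * dist x y := by
      have := Finset.sum_le_card_nsmul Finset.univ (fun j => |x j - y j|) (dist x y)
        (fun j _ => by rw [← Real.dist_eq]; exact dist_le_pi_dist x y j)
      simpa using this
    calc _ ≤ (1 - r) * (L * (A * dist x y)) := mul_le_mul_of_nonneg_left
          ((hLip x hx y hy i).trans (mul_le_mul_of_nonneg_left h1 hL)) hs0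
      _ = (1 - r) * (L * A) * dist x y := by ring
      _ ≤ _ := mul_le_mul_of_nonneg_right hs dist_nonneg
  · have h1 : (∑ j, |x j - y j|) ^ 2 ≤ A * ∑ j, (x j - y j) ^ 2 := by
      simpa using sq_sum_le_card_mul_sum_sq (s := Finset.univ) (f := fun j => |x j - y j|)
    calc _ ≤ ∑ i, (1 - r) * (L * ∑ j, |x j - y j|) * |x i - y i| := by
          refine Finset.sum_le_sum fun i _ => ?_
          refine (le_abs_self _).trans ?_
          rw [hT, abs_mul, abs_mul, abs_of_nonneg hs0]
          exact mul_le_mul_of_nonneg_right (mul_le_mul_of_nonneg_left (hLip x hx y hy i) hs0)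
            (abs_nonneg _)
      _ = (1 - r) * L * (∑ j, |x j - y j|) ^ 2 := by rw [← Finset.mul_sum]; ring
      _ ≤ (1 - r) * L * (A * ∑ j, (x j - y j) ^ 2) :=
          mul_le_mul_of_nonneg_left h1 (by positivity)
      _ = (1 - r) * (L * A) * ∑ j, (x j - y j) ^ 2 := by ring
      _ ≤ _ := mul_le_mul_of_nonneg_right hs (Finset.sum_nonneg fun j _ => sq_nonneg _)

/-- Banach's theorem is applied on the face where wageless agents own nothing. This face is closed,
contains γ, and is invariant because 0 ^ β = 0, so the vanishing shares come with the fixed point.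
-/
theorem exists_meanIncrement_fixedPoint (hα : ∀ i, 0 < α i) (hβ : 1 ≤ β) {r : ℝ} (hr0 : 0 ≤ r)
    (hr1 : r ≤ 1) {γ : Fin A → ℝ} (hγ : γ ∈ stdSimplex ℝ (Fin A))
    (hc : ∀ x ∈ stdSimplex ℝ (Fin A), ∀ y ∈ stdSimplex ℝ (Fin A),
      dist (meanIncrement r γ α β x) (meanIncrement r γ α β y) ≤ 1 / 4 * dist x y) :
    ∃ z ∈ stdSimplex ℝ (Fin A), meanIncrement r γ α β z = z ∧ ∀ i, γ i = 0 → z i = 0 := by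
  set s : Set (Fin A → ℝ) := stdSimplex ℝ (Fin A) ∩ {x | ∀ i, γ i = 0 → x i = 0} with hs
  have hsc : IsClosed s := by
    refine (isClosed_stdSimplex ℝ (Fin A)).inter ?_
    simp only [Set.ofPred_forall]
    exact isClosed_iInter fun i => isClosed_iInter fun _ =>
      isClosed_eq (continuous_apply i) continuous_const
  have hmaps : Set.MapsTo (meanIncrement r γ α β) s s := fun x hx =>
    ⟨meanIncrement_mem_stdSimplex hα hr0 hr1 hγ hx.1, fun i hi => by
      simp [meanIncrement, winProb, powerFeedback, hi, hx.2 i hi,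
        Real.zero_rpow (show β ≠ 0 by linarith)]⟩
  have hcw : ContractingWith (1 / 4) (hmaps.restrict (meanIncrement r γ α β) s s) := by
    refine ⟨by rw [← NNReal.coe_lt_coe]; norm_num, LipschitzWith.of_dist_le_mul fun x y => ?_⟩
    simpa [Subtype.dist_eq] using hc x x.2.1 y y.2.1
  obtain ⟨z, hz, hfix, -⟩ := hcw.exists_fixedPoint' hsc.isComplete hmaps (x := γ)
    ⟨hγ, fun i hi => hi⟩ (edist_ne_top _ _)
  exact ⟨z, hz.1, hfix, hz.2⟩

/-! ### Almost sure convergence from a conditional contraction -/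

/-- A bounded nonnegative process with conditional contraction rate `3 / (2 (N + n + 1))` and a
square-summable error vanishes in the limit almost surely. -/
theorem ae_tendsto_zero_of_condExp_le {Ω : Type*} {m0 : MeasurableSpace Ω} {μ : Measure Ω}
    [IsProbabilityMeasure μ] {ℱ : Filtration ℕ m0} {f : ℕ → Ω → ℝ} {B C N : ℝ}
    (hN : 1 ≤ N) (hC : 0 ≤ C) (hadp : StronglyAdapted ℱ f) (h0 : ∀ n ω, 0 ≤ f n ω)
    (hB : ∀ n ω, f n ω ≤ B)
    (hle : ∀ n : ℕ, μ[f (n + 1) | ℱ n] ≤ᵐ[μ]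
      fun ω => (1 - 3 / 2 / (N + n + 1)) * f n ω + C / (N + n + 1) ^ 2) :
    ∀ᵐ ω ∂μ, Tendsto (fun n => f n ω) atTop (𝓝 0) := by
  have hmeas : ∀ n, AEStronglyMeasurable (f n) μ := fun n =>
    ((hadp n).mono (ℱ.le n)).aestronglyMeasurable
  have hint : ∀ n, Integrable (f n) μ := fun n =>
    Integrable.of_bound (hmeas n) B (ae_of_all _ fun ω => by
      rw [Real.norm_eq_abs, abs_of_nonneg (h0 n ω)]
      exact hB n ω)
  have hpos : ∀ n : ℕ, 1 ≤ N + n := fun n => by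
    have : (0 : ℝ) ≤ n := n.cast_nonneg
    linarith
  have hcn : Tendsto (fun n : ℕ => N + (n : ℝ)) atTop atTop :=
    tendsto_atTop_add_const_left _ _ tendsto_natCast_atTop_atTop
  have hmean : Tendsto (fun n => ∫ ω, f n ω ∂μ) atTop (𝓝 0) := by
    -- N B covers n = 0 and 2 C the induction step: a rate of exactly 1 would just carry K / m to K
    -- / (m + 1), and the surplus 1/2 in the rate pays for the error.
    set K := 2 * C + N * B with hK
    have hrec : ∀ n : ℕ, ∫ ω, f n ω ∂μ ≤ K / (N + n) := by
      intro n
      induction n with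
      | zero =>
        have h1 : ∫ ω, f 0 ω ∂μ ≤ B := by
          simpa using integral_mono (hint 0) (integrable_const B) (hB 0)
        rw [le_div_iff₀ (by simpa using by linarith)]
        simp only [Nat.cast_zero, add_zero]
        nlinarith
      | succ n ih =>
        have hB0 : 0 ≤ B := by
          obtain ⟨ω⟩ := (inferInstance : (ae μ).NeBot).nonempty
          exact (h0 0 ω).trans (hB 0 ω)
        have h1 : ∫ ω, f (n + 1) ω ∂μ
            ≤ (1 - 3 / 2 / (N + n + 1)) * ∫ ω, f n ω ∂μ + C / (N + n + 1) ^ 2 := by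
          rw [← integral_condExp (ℱ.le n)]
          refine (integral_mono_ae integrable_condExp
            (((hint n).const_mul _).add (integrable_const _)) (hle n)).trans_eq ?_
          simp only [Pi.add_apply]
          rw [integral_add ((hint n).const_mul _) (integrable_const _), integral_const_mul]
          simp
        have hm := hpos n
        push_cast
        rw [← add_assoc]
        set m := N + (n : ℝ) with hmdef
        have hcoef : 0 ≤ 1 - 3 / 2 / (m + 1) := by
          rw [sub_nonneg, div_le_one (by linarith)]
          linarith
        refine h1.trans ((add_le_add_left (mul_le_mul_of_nonneg_left ih hcoef) _).trans ?_)
        have hm0 : 0 < m := by linarith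
        have hKC : 2 * C ≤ K := by nlinarith
        have hid : K / (m + 1) - ((1 - 3 / 2 / (m + 1)) * (K / m) + C / (m + 1) ^ 2)
            = (K * (m + 1) / 2 - C * m) / (m * (m + 1) ^ 2) := by
          field_simp
          ring
        have : 0 ≤ (K * (m + 1) / 2 - C * m) / (m * (m + 1) ^ 2) := by
          apply div_nonneg _ (by positivity)
          nlinarith
        linarith
    exact squeeze_zero (fun n => integral_nonneg (h0 n)) hrec (hcn.const_div_atTop K)
  -- The contraction is dropped here. The compensator C / (N + n) absorbs the errors, since 1 / m -
  -- 1 / (m + 1) ≥ 1 / (m + 1)².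
  have hsup : Supermartingale (fun (n : ℕ) ω => f n ω + C / (N + n)) ℱ μ := by
    refine supermartingale_nat (fun n => (hadp n).add stronglyMeasurable_const)
      (fun n => (hint n).add (integrable_const _)) fun n => ?_
    have hadd := condExp_add (hint (n + 1))
      (integrable_const (μ := μ) (C / (N + ((n + 1 : ℕ) : ℝ)))) (ℱ n)
    rw [condExp_const (ℱ.le n)] at hadd
    filter_upwards [hadd, hle n] with ω h1 h2
    refine h1.le.trans ?_
    simp only [Pi.add_apply]
    push_cast
    rw [← add_assoc]
    have hm := hpos n
    set m := N + (n : ℝ) with hmdef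
    have hm0 : 0 < m := by linarith
    have h3 : 0 ≤ 3 / 2 / (m + 1) * f n ω := mul_nonneg (by positivity) (h0 n ω)
    have h4 : C / (m + 1) ^ 2 + C / (m + 1) ≤ C / m := by
      have hid : C / m - (C / (m + 1) ^ 2 + C / (m + 1)) = C / (m * (m + 1) ^ 2) := by
        field_simp
        ring
      have : 0 ≤ C / (m * (m + 1) ^ 2) := by positivity
      linarith
    linarith
  have hconv : ∀ᵐ ω ∂μ, ∃ c, Tendsto (fun n => f n ω) atTop (𝓝 c) := by
    have hbdd : ∀ n, eLpNorm ((-fun (n : ℕ) ω => f n ω + C / (N + n)) n) 1 μ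
        ≤ ((B + C).toNNReal : ENNReal) := by
      intro n
      have := eLpNorm_le_of_ae_bound (p := 1) (μ := μ) (C := B + C)
        (f := (-fun (n : ℕ) ω => f n ω + C / (N + n)) n) (ae_of_all _ fun ω => by
          have h1 : 0 ≤ C / (N + n) := div_nonneg hC (by linarith [hpos n])
          have h2 : C / (N + n) ≤ C := div_le_self hC (hpos n)
          simp only [Pi.neg_apply, norm_neg, Real.norm_eq_abs]
          rw [abs_of_nonneg (add_nonneg (h0 n ω) h1)]
          exact add_le_add (hB n ω) h2)
      simpa [ENNReal.ofReal] using this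
    filter_upwards [hsup.neg.ae_tendsto_limitProcess hbdd] with ω hω
    refine ⟨_, (hω.neg.sub (hcn.const_div_atTop C)).congr fun n => ?_⟩
    simp
  obtain ⟨g, hg, hlim⟩ : ∃ g : Ω → ℝ, StronglyMeasurable g ∧
      ∀ᵐ ω ∂μ, Tendsto (fun n => f n ω) atTop (𝓝 (g ω)) :=
    exists_stronglyMeasurable_limit_of_tendsto_ae hmeas hconv
  have hgB : ∀ᵐ ω ∂μ, 0 ≤ g ω ∧ g ω ≤ B := by
    filter_upwards [hlim] with ω hω
    exact ⟨ge_of_tendsto' hω fun n => h0 n ω, le_of_tendsto' hω fun n => hB n ω⟩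
  have hgint : Integrable g μ :=
    Integrable.of_bound hg.aestronglyMeasurable B (hgB.mono fun ω h => by
      rw [Real.norm_eq_abs, abs_of_nonneg h.1]
      exact h.2)
  -- The limit is nonnegative and has mean 0, hence vanishes almost surely.
  have hdom := tendsto_integral_of_dominated_convergence (fun _ => B) hmeas (integrable_const B)
    (fun n => ae_of_all _ fun ω => by
      rw [Real.norm_eq_abs, abs_of_nonneg (h0 n ω)]
      exact hB n ω) hlim
  have hzero := (integral_eq_zero_iff_of_nonneg_ae (hgB.mono fun ω h => h.1) hgint).1
    (tendsto_nhds_unique hdom hmean)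
  filter_upwards [hlim, hzero] with ω h1 h2
  rwa [h2] at h1

/-! ### Total wealth along the process -/

/-- The wealth vectors with nonnegative entries and total `m`. -/
def wealthSimplex (A : ℕ) (m : ℝ) : Set (Fin A → ℝ) :=
  {x | (∀ i, 0 ≤ x i) ∧ ∑ i, x i = m}

theorem measurableSet_wealthSimplex (m : ℝ) : MeasurableSet (wealthSimplex A m) := by
  have h : IsClosed (wealthSimplex A m) := by
    have h1 : IsClosed {x : Fin A → ℝ | ∀ i, 0 ≤ x i} := by
      simp only [Set.ofPred_forall]
      exact isClosed_iInter fun i => isClosed_le continuous_const (continuous_apply i)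
    exact h1.inter (isClosed_eq (continuous_finsetSum _ fun i _ => continuous_apply i)
      continuous_const)
  exact h.measurableSet

theorem increment_mem_stdSimplex {r : ℝ} (hr0 : 0 ≤ r) (hr1 : r ≤ 1) {γ : Fin A → ℝ}
    (hγ : γ ∈ stdSimplex ℝ (Fin A)) (i : Fin A) : increment r γ i ∈ stdSimplex ℝ (Fin A) :=
  convex_stdSimplex ℝ (Fin A) (single_mem_stdSimplex ℝ i) hγ (by linarith) hr0 (by ring)

theorem add_increment_mem_wealthSimplex {r : ℝ} (hr0 : 0 ≤ r) (hr1 : r ≤ 1) {γ : Fin A → ℝ}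
    (hγ : γ ∈ stdSimplex ℝ (Fin A)) (i : Fin A) {m : ℝ} {x : Fin A → ℝ}
    (hx : x ∈ wealthSimplex A m) : x + increment r γ i ∈ wealthSimplex A (m + 1) := by
  have hv := increment_mem_stdSimplex hr0 hr1 hγ i
  refine ⟨fun j => add_nonneg (hx.1 j) (hv.1 j), ?_⟩
  simp only [Pi.add_apply, Finset.sum_add_distrib]
  rw [hx.2, hv.2]

theorem inv_smul_mem_stdSimplex {m : ℝ} (hm : 0 < m) {x : Fin A → ℝ} (hx : x ∈ wealthSimplex A m) :
    m⁻¹ • x ∈ stdSimplex ℝ (Fin A) := by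
  refine ⟨fun j => mul_nonneg (by positivity) (hx.1 j), ?_⟩
  simp only [Pi.smul_apply, smul_eq_mul, ← Finset.mul_sum]
  rw [hx.2, inv_mul_cancel₀ hm.ne']

/-- The transition law is known only through test functions, so it is tested on the indicator of the
next simplex: every possible step lands there, hence the indicator has mean 1. -/
theorem IsWealthProcess.ae_mem_wealthSimplex (hα : ∀ i, 0 < α i) {r : ℝ} (hr0 : 0 ≤ r)
    (hr1 : r ≤ 1) {γ : Fin A → ℝ} (hγ : γ ∈ stdSimplex ℝ (Fin A)) {x₀ : Fin A → ℝ}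
    (hx₀ : ∀ i, 0 ≤ x₀ i) (hpos : 0 < ∑ i, x₀ i) {Ω : Type*} [MeasurableSpace Ω] {μ : Measure Ω}
    [IsProbabilityMeasure μ] {X : ℕ → Ω → (Fin A → ℝ)}
    (hX : IsWealthProcess r γ (powerFeedback α β) x₀ μ X) (n : ℕ) :
    ∀ᵐ ω ∂μ, X n ω ∈ wealthSimplex A (∑ i, x₀ i + n) := by
  induction n with
  | zero =>
    filter_upwards [hX.initial] with ω hω
    rw [hω]
    exact ⟨hx₀, by simp⟩
  | succ n ih =>
    push_cast
    rw [← add_assoc]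
    set m : ℝ := ∑ i, x₀ i + n with hm
    have hm0 : 0 < m := by positivity
    have hS := measurableSet_wealthSimplex (A := A) (m + 1)
    set f : (Fin A → ℝ) → ℝ := (wealthSimplex A (m + 1)).indicator fun _ => 1 with hf
    have hfm : Measurable f := measurable_const.indicator hS
    have hf1 : ∀ x, f x ≤ 1 := Set.indicator_le' (fun _ _ => le_rfl) (fun _ _ => zero_le_one)
    have hf0 : ∀ x, 0 ≤ f x := Set.indicator_nonneg fun _ _ => zero_le_one
    have hfb : ∀ x, |f x| ≤ 1 := fun x => by
      rw [abs_of_nonneg (hf0 x)]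
      exact hf1 x
    have hint : Integrable (fun ω => f (X (n + 1) ω)) μ :=
      Integrable.of_bound (hfm.comp (hX.stronglyMeasurable (n + 1)).measurable).aestronglyMeasurable
        1 (ae_of_all _ fun ω => hfb _)
    have hone : ∫ ω, f (X (n + 1) ω) ∂μ = 1 := by
      rw [← integral_condExp ((Filtration.natural X hX.stronglyMeasurable).le n),
        integral_congr_ae (hX.markov n f hfm ⟨1, hfb⟩)]
      have : (fun ω => ∑ i, winProb (powerFeedback α β) (X n ω) i * f (X n ω + increment r γ i))
          =ᵐ[μ] fun _ => 1 := by
        filter_upwards [ih] with ω hω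
        rw [← sum_winProb hα hω.1 (hω.2 ▸ hm0)]
        refine Finset.sum_congr rfl fun i _ => ?_
        rw [hf, Set.indicator_of_mem (add_increment_mem_wealthSimplex hr0 hr1 hγ i hω), mul_one]
      rw [integral_congr_ae this]
      simp
    have hzero : ∫ ω, (1 - f (X (n + 1) ω)) ∂μ = 0 := by
      rw [integral_sub (integrable_const _) hint, hone]
      simp
    have hae := (integral_eq_zero_iff_of_nonneg (fun ω => sub_nonneg.2 (hf1 _))
      ((integrable_const _).sub hint)).1 hzero
    filter_upwards [hae] with ω hω
    by_contra hmem
    simp [hf, Set.indicator_of_notMem hmem] at hω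

/-! ### Drift of the squared distance and convergence of the shares -/

theorem sum_sq_sub_le {x y : Fin A → ℝ} (hx : x ∈ stdSimplex ℝ (Fin A))
    (hy : y ∈ stdSimplex ℝ (Fin A)) : ∑ k, (x k - y k) ^ 2 ≤ A := by
  have hmem : ∀ z ∈ stdSimplex ℝ (Fin A), ∀ j, z j ≤ 1 := fun z hz j =>
    hz.2 ▸ Finset.single_le_sum (fun k _ => hz.1 k) (Finset.mem_univ j)
  have h := Finset.sum_le_card_nsmul Finset.univ (fun k => (x k - y k) ^ 2) 1 fun k _ => by
    rw [sq_le_one_iff_abs_le_one, abs_le]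
    constructor <;> linarith [hx.1 k, hy.1 k, hmem x hx k, hmem y hy k]
  simpa using h

theorem sum_winProb_mul_increment (hα : ∀ i, 0 < α i) (r : ℝ) (γ : Fin A → ℝ) {x : Fin A → ℝ}
    (hx : x ∈ stdSimplex ℝ (Fin A)) (k : Fin A) :
    ∑ i, winProb (powerFeedback α β) x i * increment r γ i k = meanIncrement r γ α β x k := by
  have h1 : ∀ i, winProb (powerFeedback α β) x i * increment r γ i k
      = (1 - r) * (winProb (powerFeedback α β) x i * (Pi.single i (1 : ℝ) : Fin A → ℝ) k)
        + r * γ k * winProb (powerFeedback α β) x i := by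
    intro i
    simp only [increment, Pi.add_apply, Pi.smul_apply, smul_eq_mul]
    ring
  simp only [h1, Finset.sum_add_distrib, ← Finset.mul_sum]
  rw [(winProb_mem_stdSimplex (β := β) hα hx).2]
  simp [meanIncrement, Pi.single_apply]

/-- One step of the shares decreases the mean squared distance to the fixed point. -/
theorem sum_winProb_mul_sq_dist_le (hα : ∀ i, 0 < α i) {r : ℝ} (hr0 : 0 ≤ r)
    (hr1 : r ≤ 1) {γ : Fin A → ℝ} (hγ : γ ∈ stdSimplex ℝ (Fin A)) {z : Fin A → ℝ}
    (hfix : meanIncrement r γ α β z = z) {x : Fin A → ℝ} (hx : x ∈ stdSimplex ℝ (Fin A))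
    (hdrift : ∑ k, (meanIncrement r γ α β x k - meanIncrement r γ α β z k) * (x k - z k)
      ≤ 1 / 4 * ∑ k, (x k - z k) ^ 2) {h : ℝ} (hh : 0 ≤ h) :
    ∑ i, winProb (powerFeedback α β) x i
        * ∑ k, (x k + h * (increment r γ i k - x k) - z k) ^ 2
      ≤ (1 - 3 / 2 * h) * ∑ k, (x k - z k) ^ 2 + A * h ^ 2 := by
  have hp := winProb_mem_stdSimplex (β := β) hα hx
  set p := winProb (powerFeedback α β) x with hpdef
  have hlin : ∑ i, p i * ∑ k, (x k - z k) * (increment r γ i k - x k)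
      = ∑ k, (meanIncrement r γ α β x k - meanIncrement r γ α β z k) * (x k - z k)
        - ∑ k, (x k - z k) ^ 2 := by
    simp only [Finset.mul_sum]
    rw [Finset.sum_comm, ← Finset.sum_sub_distrib]
    refine Finset.sum_congr rfl fun k _ => ?_
    have h1 : ∑ i, p i * ((x k - z k) * (increment r γ i k - x k))
        = (x k - z k) * (∑ i, p i * increment r γ i k - (∑ i, p i) * x k) := by
      rw [Finset.sum_mul, ← Finset.sum_sub_distrib, Finset.mul_sum]
      exact Finset.sum_congr rfl fun i _ => by ring
    rw [h1, hp.2, sum_winProb_mul_increment hα r γ hx, hfix]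
    ring
  have hquad : ∑ i, p i * ∑ k, (increment r γ i k - x k) ^ 2 ≤ A := by
    calc _ ≤ ∑ i, p i * A := Finset.sum_le_sum fun i _ => mul_le_mul_of_nonneg_left
          (sum_sq_sub_le (increment_mem_stdSimplex hr0 hr1 hγ i) hx) (hp.1 i)
      _ = A := by rw [← Finset.sum_mul, hp.2, one_mul]
  have hexp : ∑ i, p i * ∑ k, (x k + h * (increment r γ i k - x k) - z k) ^ 2
      = (∑ i, p i) * ∑ k, (x k - z k) ^ 2
        + 2 * h * ∑ i, p i * ∑ k, (x k - z k) * (increment r γ i k - x k)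
        + h ^ 2 * ∑ i, p i * ∑ k, (increment r γ i k - x k) ^ 2 := by
    rw [Finset.sum_mul, Finset.mul_sum, Finset.mul_sum, ← Finset.sum_add_distrib,
      ← Finset.sum_add_distrib]
    refine Finset.sum_congr rfl fun i _ => ?_
    have : ∑ k, (x k + h * (increment r γ i k - x k) - z k) ^ 2
        = ∑ k, (x k - z k) ^ 2 + 2 * h * ∑ k, (x k - z k) * (increment r γ i k - x k)
          + h ^ 2 * ∑ k, (increment r γ i k - x k) ^ 2 := by
      rw [Finset.mul_sum, Finset.mul_sum, ← Finset.sum_add_distrib, ← Finset.sum_add_distrib]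
      exact Finset.sum_congr rfl fun k _ => by ring
    rw [this]
    ring
  rw [hexp, hlin, hp.2]
  -- The cross term contributes 2 h (1/4 - 1) = -3/2 h times the squared distance.
  nlinarith [mul_le_mul_of_nonneg_left hdrift hh, mul_le_mul_of_nonneg_left hquad (sq_nonneg h)]

theorem IsWealthProcess.ae_tendsto_shares (hα : ∀ i, 0 < α i) {r : ℝ} (hr0 : 0 ≤ r)
    (hr1 : r ≤ 1) {γ : Fin A → ℝ} (hγ : γ ∈ stdSimplex ℝ (Fin A)) {z : Fin A → ℝ}
    (hz : z ∈ stdSimplex ℝ (Fin A)) (hfix : meanIncrement r γ α β z = z)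
    (hdrift : ∀ x ∈ stdSimplex ℝ (Fin A),
      ∑ k, (meanIncrement r γ α β x k - meanIncrement r γ α β z k) * (x k - z k)
        ≤ 1 / 4 * ∑ k, (x k - z k) ^ 2) {x₀ : Fin A → ℝ}
    (hx₀ : ∀ i, 0 ≤ x₀ i) (hN : 1 ≤ ∑ i, x₀ i) {Ω : Type*} [MeasurableSpace Ω] {μ : Measure Ω}
    [IsProbabilityMeasure μ] {X : ℕ → Ω → (Fin A → ℝ)}
    (hX : IsWealthProcess r γ (powerFeedback α β) x₀ μ X) :
    ∀ᵐ ω ∂μ, Tendsto (fun n => shares x₀ X n ω) atTop (𝓝 z) := by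
  have hmem := hX.ae_mem_wealthSimplex hα hr0 hr1 hγ hx₀ (by linarith)
  set N := ∑ i, x₀ i with hNdef
  have hpos : ∀ n : ℕ, 0 < N + n := fun n => by positivity
  let V : (Fin A → ℝ) → ℝ := fun x => ∑ k, (x k - z k) ^ 2
  have hVm : Measurable V := by fun_prop
  have hV0 : ∀ x, 0 ≤ V x := fun x => Finset.sum_nonneg fun k _ => sq_nonneg _
  -- `markov` needs test functions bounded on the whole space; the cap A is inactive on the simplex,
  -- where the process almost surely lives.
  let φ : ℕ → (Fin A → ℝ) → ℝ := fun n x => min (V ((N + n)⁻¹ • x)) A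
  have hφm : ∀ n, Measurable (φ n) := fun n =>
    (hVm.comp (measurable_const_smul _)).min measurable_const
  have hφ0 : ∀ n x, 0 ≤ φ n x := fun n x => le_min (hV0 _) A.cast_nonneg
  have hφA : ∀ n x, φ n x ≤ A := fun n x => min_le_right _ _
  have hφV : ∀ (n : ℕ) (x), x ∈ wealthSimplex A (N + n) → φ n x = V ((N + n)⁻¹ • x) := fun n x hx =>
    min_eq_left (sum_sq_sub_le (inv_smul_mem_stdSimplex (hpos n) hx) hz)
  have hconv := ae_tendsto_zero_of_condExp_le (μ := μ)
    (ℱ := Filtration.natural X hX.stronglyMeasurable)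
    (f := fun n ω => φ n (X n ω)) (B := A) (C := A) hN A.cast_nonneg
    (fun n => ((hφm n).comp
      (Filtration.stronglyAdapted_natural hX.stronglyMeasurable n).measurable).stronglyMeasurable)
    (fun n ω => hφ0 n _) (fun n ω => hφA n _) (fun n => by
      have hφb : ∀ x, |φ (n + 1) x| ≤ A := fun x => by
        rw [abs_of_nonneg (hφ0 _ x)]
        exact hφA _ x
      filter_upwards [hX.markov n (φ (n + 1)) (hφm _) ⟨A, hφb⟩, hmem n] with ω h1 h2
      rw [h1, hφV n _ h2]
      have hm := hpos n
      set m := N + (n : ℝ) with hmdef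
      have hx := inv_smul_mem_stdSimplex hm h2
      set x := m⁻¹ • X n ω with hxdef
      have hXx : X n ω = m • x := by rw [hxdef, smul_inv_smul₀ hm.ne']
      have hp : winProb (powerFeedback α β) (X n ω) = winProb (powerFeedback α β) x := by
        rw [hXx, winProb_powerFeedback_smul α β hm hx.1]
      -- The step size is (m + 1)⁻¹ because (m x + v) / (m + 1) = x + (v - x) / (m + 1).
      have hstep := sum_winProb_mul_sq_dist_le hα hr0 hr1 hγ hfix hx (hdrift x hx)
        (h := (m + 1)⁻¹) (by positivity)
      calc _ ≤ ∑ i, winProb (powerFeedback α β) x i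
            * ∑ k, (x k + (m + 1)⁻¹ * (increment r γ i k - x k) - z k) ^ 2 := by
            rw [hp]
            refine Finset.sum_le_sum fun i _ => mul_le_mul_of_nonneg_left
              ((min_le_left _ _).trans_eq ?_) (winProb_nonneg hα hx.1 i)
            refine Finset.sum_congr rfl fun k _ => ?_
            rw [hXx]
            simp only [Pi.smul_apply, Pi.add_apply, smul_eq_mul]
            push_cast
            rw [← add_assoc, ← hmdef]
            congr 2
            field_simp
            ring
        _ ≤ _ := hstep
        _ = _ := by
            simp only [V, div_eq_mul_inv, inv_pow])
  filter_upwards [hconv, ae_all_iff.2 hmem] with ω h1 h2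
  rw [tendsto_pi_nhds]
  intro k
  rw [tendsto_iff_dist_tendsto_zero]
  have h3 : Tendsto (fun n => √(φ n (X n ω))) atTop (𝓝 0) := by
    simpa using h1.sqrt
  refine squeeze_zero (fun n => dist_nonneg) (fun n => ?_) h3
  rw [Real.dist_eq, hφV n _ (h2 n)]
  exact Real.abs_le_sqrt (Finset.single_le_sum
    (f := fun k => (shares x₀ X n ω k - z k) ^ 2) (fun j _ => sq_nonneg _) (Finset.mem_univ k))

end
end WealthUrn

theorem mainTheorem2 (A : ℕ) (hA : 2 ≤ A) (α : Fin A → ℝ) (hα : ∀ i, 0 < α i)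
    (β : ℝ) (hβ : 1 ≤ β) :
    ∃ r_c : ℝ, 0 < r_c ∧ r_c < 1 ∧
      ∀ r : ℝ, r_c ≤ r → r ≤ 1 → ∀ γ ∈ stdSimplex ℝ (Fin A),
        ∃ χ_lim ∈ stdSimplex ℝ (Fin A),
          -- the limit is the only zero of the field in the simplex
          (∀ x ∈ stdSimplex ℝ (Fin A), WealthUrn.field r γ α β x = 0 ↔ x = χ_lim) ∧
          -- the shares converge almost surely to this deterministic point
          (∀ x₀ : Fin A → ℝ, (∀ i, 1 ≤ x₀ i) →
            ∀ {Ω : Type*} [MeasurableSpace Ω] (μ : Measure Ω) [IsProbabilityMeasure μ]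
              (X : ℕ → Ω → (Fin A → ℝ)),
              WealthUrn.IsWealthProcess r γ (WealthUrn.powerFeedback α β) x₀ μ X →
              ∀ᵐ ω ∂μ, Tendsto (fun n => WealthUrn.shares x₀ X n ω) atTop (𝓝 χ_lim)) ∧
          -- agents without wage have vanishing limiting share
          (∀ i, γ i = 0 → χ_lim i = 0) := by
  obtain ⟨r_c, h0, h1, hc⟩ := WealthUrn.exists_meanIncrement_contracting (A := A) hα hβ
  refine ⟨r_c, h0, h1, fun r hr hr1 γ hγ => ?_⟩
  have hr0 : 0 ≤ r := h0.le.trans hr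
  obtain ⟨z, hz, hfix, hzero⟩ := WealthUrn.exists_meanIncrement_fixedPoint hα hβ hr0 hr1 hγ
    fun x hx y hy => (hc r hr hr1 γ x hx y hy).1
  refine ⟨z, hz, fun x hx => ?_, fun x₀ hx₀ Ω _ μ _ X hX => ?_, hzero⟩
  · have hfield : WealthUrn.field r γ α β x = 0 ↔ WealthUrn.meanIncrement r γ α β x = x :=
      sub_eq_zero
    rw [hfield]
    refine ⟨fun h => ?_, fun h => h ▸ hfix⟩
    have hd := (hc r hr hr1 γ x hx z hz).1
    rw [h, hfix] at hd
    exact dist_le_zero.1 (by linarith [dist_nonneg (x := x) (y := z)])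
  · have hx0 : ∀ i, 0 ≤ x₀ i := fun i => zero_le_one.trans (hx₀ i)
    have hN : 1 ≤ ∑ i, x₀ i := (hx₀ ⟨0, by omega⟩).trans
      (Finset.single_le_sum (fun i _ => hx0 i) (Finset.mem_univ _))
    exact hX.ae_tendsto_shares hα hr0 hr1 hγ hz hfix
      (fun x hx => (hc r hr hr1 γ x hx z hz).2) hx0 hN
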